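/- Let $G$ be a Lie group with a left-invariant Riemannian metric $\mathsf h$, and let $X$ be a non-zero left-invariant vector field on $G$ with $\|X\|=\sqrt{\mathsf h(X,X)}<1$. Let $F(x,y)=\sqrt{\mathsf h(y,y)}+\mathsf h(X(x),y)$ be the associated left-invariant Randers metric. For $x\in G$ and $y\in T_xG\setminus\{0\}$ let $$g_y(u,v)=\tfrac12\,\frac{\partial^2}{\partial s\,\partial t}F^2(x,y+su+tv)\Big|_{s=t=0}$$ be the fundamental tensor of $F$, and let $g_X$ be the metric on $G$ whose value at $x$ is the fundamental tensor at $y=X(x)$. Assume that $\sqrt{g_X(X,X)}<1$, and let $$\tilde F(x,y)=\sqrt{g_X(y,y)}+g_X(X(x),y).$$ Then: 1. $F$ is of Douglas type if and only if $\tilde F$ is of Douglas type. 2. $F$ is of Berwald type if and only if $\tilde F$ is of Berwald type. Here the spray coefficients of a Finsler metric $L$ in a chart with induced coordinates $(x^i,y^i)$ of the tangent bundle are $G^i=\frac14\sum_l g^{il}\big(\sum_k\frac{\partial^2L^2}{\partial x^k\partial y^l}y^k-\frac{\partial L^2}{\partial x^l}\big)$, where $(g^{il})$ is the inverse of $\big(\frac12\frac{\partial^2L^2}{\partial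 y^i\partial y^l}\big)$. The metric $L$ is of Berwald type if in every chart $G^i(x,y)=\frac12\sum_{j,k}\Gamma^i_{jk}(x)y^jy^k$ for $y\neq0$, and of Douglas type if in every chart $G^i(x,y)=\frac12\sum_{j,k}\Gamma^i_{jk}(x)y^jy^k+P(x,y)y^i$ for $y\neq0$, for some functions $\Gamma^i_{jk}$ and $P$. -/

import Mathlib

open scoped Manifold ContDiff

noncomputable section

/-- The fundamental tensor at `y` of a Minkowski norm `f` on a real vector space:
`g_y(u, v) = (1/2) ∂²/∂s∂t f²(y + s u + t v)` at `s = t = 0`. -/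
def fundamentalTensor {V : Type*} [AddCommGroup V] [Module ℝ V] (f : V → ℝ) (y u v : V) : ℝ :=
  (1 / 2) * deriv (fun s : ℝ => deriv (fun t : ℝ => f (y + s • u + t • v) ^ 2) 0) 0

section Coordinates

variable {n : ℕ}

/-- The fundamental tensor `g_ij(x, y) = (1/2) ∂²L²/∂y^i∂y^j` of a Finsler function `L(x, y)` given
in the standard coordinates of `ℝⁿ`. -/
def fundamentalMatrix (L : EuclideanSpace ℝ (Fin n) → EuclideanSpace ℝ (Fin n) → ℝ)
    (x y : EuclideanSpace ℝ (Fin n)) : Matrix (Fin n) (Fin n) ℝ :=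
  Matrix.of fun i j =>
    fundamentalTensor (L x) y (EuclideanSpace.single i 1) (EuclideanSpace.single j 1)

/-- The spray coefficients of a Finsler function `L(x, y)` given in the standard coordinates of
`ℝⁿ`: `G^i = (1/4) ∑_l g^{il} (∑_k ∂²L²/∂x^k∂y^l y^k - ∂L²/∂x^l)`. -/
def sprayCoeff (L : EuclideanSpace ℝ (Fin n) → EuclideanSpace ℝ (Fin n) → ℝ)
    (x y : EuclideanSpace ℝ (Fin n)) (i : Fin n) : ℝ :=
  (1 / 4) * ∑ l, (fundamentalMatrix L x y)⁻¹ i l *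
    (∑ k, deriv (fun s : ℝ => deriv (fun t : ℝ =>
        L (x + s • EuclideanSpace.single k 1) (y + t • EuclideanSpace.single l 1) ^ 2) 0) 0 * y k
      - deriv (fun s : ℝ => L (x + s • EuclideanSpace.single l 1) y ^ 2) 0)

end Coordinates

section Manifold

variable {n : ℕ} {M : Type*} [TopologicalSpace M] [ChartedSpace (EuclideanSpace ℝ (Fin n)) M]

/-- The expression `L(x, y) = F(e⁻¹(x), d(e⁻¹)_x y)` of a function `F` on the tangent bundle in the
coordinates `(x, y)` induced by a chart `e`. -/
def localExpression (F : ∀ p : M, TangentSpace (𝓡 n) p → ℝ)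
    (e : OpenPartialHomeomorph M (EuclideanSpace ℝ (Fin n)))
    (x y : EuclideanSpace ℝ (Fin n)) : ℝ :=
  F (e.symm x) (mfderiv (𝓡 n) (𝓡 n) e.symm x y)

/-- A Finsler metric is of Berwald type if in every chart its spray coefficients are quadratic
in `y`: `G^i(x, y) = (1/2) ∑ Γ^i_jk(x) y^j y^k`. -/
def IsBerwaldType (F : ∀ p : M, TangentSpace (𝓡 n) p → ℝ) : Prop :=
  ∀ e ∈ IsManifold.maximalAtlas (𝓡 n) ∞ M,
    ∃ Γ : EuclideanSpace ℝ (Fin n) → Fin n → Fin n → Fin n → ℝ,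
      ∀ x ∈ e.target, ∀ y : EuclideanSpace ℝ (Fin n), y ≠ 0 → ∀ i,
        sprayCoeff (localExpression F e) x y i
          = (1 / 2) * ∑ j, ∑ k, Γ x i j k * y j * y k

/-- A Finsler metric is of Douglas type if in every chart its spray coefficients have the form
`G^i(x, y) = (1/2) ∑ Γ^i_jk(x) y^j y^k + P(x, y) y^i`. -/
def IsDouglasType (F : ∀ p : M, TangentSpace (𝓡 n) p → ℝ) : Prop :=
  ∀ e ∈ IsManifold.maximalAtlas (𝓡 n) ∞ M,
    ∃ (Γ : EuclideanSpace ℝ (Fin n) → Fin n → Fin n → Fin n → ℝ)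
      (P : EuclideanSpace ℝ (Fin n) → EuclideanSpace ℝ (Fin n) → ℝ),
      ∀ x ∈ e.target, ∀ y : EuclideanSpace ℝ (Fin n), y ≠ 0 → ∀ i,
        sprayCoeff (localExpression F e) x y i
          = (1 / 2) * ∑ j, ∑ k, Γ x i j k * y j * y k + P x y * y i

/-- The function `F(p, y) = √(a(y, y)) + a(X(p), y)` built from a metric `a` and a vector
field `X`. -/
def randersMetric (a : ∀ p : M, TangentSpace (𝓡 n) p → TangentSpace (𝓡 n) p → ℝ)
    (X : ∀ p : M, TangentSpace (𝓡 n) p) (p : M) (y : TangentSpace (𝓡 n) p) : ℝ :=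
  √(a p y y) + a p (X p) y

/-- The metric `g_X`: at each point, the fundamental tensor of `F` at the vector `X(p)`. -/
def fundamentalTensorAlong (F : ∀ p : M, TangentSpace (𝓡 n) p → ℝ)
    (X : ∀ p : M, TangentSpace (𝓡 n) p) (p : M) (u v : TangentSpace (𝓡 n) p) : ℝ :=
  fundamentalTensor (F p) (X p) u v

end Manifold

/-- A metric `a` on a Lie group is left-invariant if all left translations are isometries. -/
def IsLeftInvariantMetric {n : ℕ} {G : Type*} [TopologicalSpace G]
    [ChartedSpace (EuclideanSpace ℝ (Fin n)) G] [Group G]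
    (a : ∀ p : G, TangentSpace (𝓡 n) p → TangentSpace (𝓡 n) p → ℝ) : Prop :=
  ∀ (g p : G) (u v : TangentSpace (𝓡 n) p),
    a (g * p) (mfderiv (𝓡 n) (𝓡 n) (fun q : G => g * q) p u)
      (mfderiv (𝓡 n) (𝓡 n) (fun q : G => g * q) p v) = a p u v

end

/-! Put β = h(X, ·) and b = ‖X‖. Left invariance makes b constant on the group, and differentiating
F² at y = X gives g_X = (1 + b)h + ((1 + b)/b) β ⊗ β, hence g_X(X, ·) = (1 + b)²β. So the second
metric is again of Randers type, and its metric and form come from h and β with constant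
coefficients. Its norm hypothesis reads (1 + b)b < 1.

It remains to characterise the two types by conditions that such a change respects. For a Randers
metric √A + β with spray G, let D = 2G − Γ(y, y) be the deviation from the geodesic spray of A. The
Euler-Lagrange equations split into an angular part, where only the antisymmetrisation of dβ
survives (`spray_sub_christoffel`), and a radial part, governed by dβ(y, y) − β(Γ(y, y))
(`randersNormDeriv_spray_sub_christoffel`). Comparing y with −y then shows that Douglas type means β
closed (`douglas_iff`) and Berwald type means β parallel (`berwald_iff`).

Closedness ignores a constant factor. A parallel form stays parallel because A and lA + mβ ⊗ β then
share their Christoffel symbols (`IsParallelForm.perturb`), and the change is invertible. -/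

noncomputable section

/-- The derivative of `2 L L_w` along a curve, where `L = √Q + B` and `L_w = M / √Q + K`. -/
theorem hasDerivAt_randers_mul {Q B M K : ℝ → ℝ} {Q' B' M' K' : ℝ}
    (hQ : HasDerivAt Q Q' 0) (hB : HasDerivAt B B' 0) (hM : HasDerivAt M M' 0)
    (hK : HasDerivAt K K' 0) (hpos : 0 < Q 0) :
    HasDerivAt (fun s => 2 * (√(Q s) + B s) * (M s / √(Q s) + K s))
      (2 * ((Q' / (2 * √(Q 0)) + B') * (M 0 / √(Q 0) + K 0)
        + (√(Q 0) + B 0) * (M' / √(Q 0) - M 0 * Q' / (2 * Q 0 * √(Q 0)) + K'))) 0 := by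
  have hs : HasDerivAt (fun s => √(Q s)) (Q' / (2 * √(Q 0))) 0 := hQ.sqrt hpos.ne'
  have hne : √(Q 0) ≠ 0 := (Real.sqrt_pos.2 hpos).ne'
  have hsq : √(Q 0) ^ 2 = Q 0 := Real.sq_sqrt hpos.le
  refine (((hs.add hB).const_mul 2).mul ((hM.div hs hne).add hK)).congr_deriv ?_
  simp only [Pi.add_apply, Pi.div_apply]
  rw [show M 0 * Q' / (2 * Q 0 * √(Q 0)) = M 0 * Q' / (2 * √(Q 0) ^ 2 * √(Q 0)) by rw [hsq]]
  field_simp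

/-! ### Randers norms on a single vector space and their fundamental tensor. -/

section VectorSpace

variable {V : Type*} [AddCommGroup V] [Module ℝ V]

/-- The Randers norm `√(A(y, y)) + β(y)`. -/
def randersNorm (A : V →ₗ[ℝ] V →ₗ[ℝ] ℝ) (β : V →ₗ[ℝ] ℝ) (y : V) : ℝ := √(A y y) + β y

/-- The derivative of the Randers norm at `y` in the direction `w`. -/
def randersNormDeriv (A : V →ₗ[ℝ] V →ₗ[ℝ] ℝ) (β : V →ₗ[ℝ] ℝ) (y w : V) : ℝ :=
  A y w / √(A y y) + β w

variable {A : V →ₗ[ℝ] V →ₗ[ℝ] ℝ} {β : V →ₗ[ℝ] ℝ}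

theorem hasDerivAt_linear_line (β : V →ₗ[ℝ] ℝ) (y w : V) :
    HasDerivAt (fun t : ℝ => β (y + t • w)) (β w) 0 := by
  simp only [map_add, map_smul, smul_eq_mul]
  simpa using ((hasDerivAt_id (0 : ℝ)).mul_const (β w)).const_add (β y)

theorem hasDerivAt_quadratic_line (hA : ∀ u w, A u w = A w u) (y w : V) :
    HasDerivAt (fun t : ℝ => A (y + t • w) (y + t • w)) (2 * A y w) 0 := by
  have h1 : ∀ t : ℝ, A (y + t • w) (y + t • w) = A y y + t * (2 * A y w) + t ^ 2 * A w w := by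
    intro t
    simp only [map_add, map_smul, LinearMap.add_apply, LinearMap.smul_apply, smul_eq_mul, hA w y]
    ring
  simp only [h1]
  have h2 := (((hasDerivAt_id (0 : ℝ)).mul_const (2 * A y w)).const_add (A y y)).add
    (((hasDerivAt_id (0 : ℝ)).pow 2).mul_const (A w w))
  simp only [id, one_mul, mul_zero, Nat.cast_ofNat, zero_mul, add_zero, mul_one,
    Nat.add_one_sub_one, pow_one] at h2
  exact h2

theorem hasDerivAt_randersNorm_sq (hA : ∀ u w, A u w = A w u) {y : V} (hy : 0 < A y y) (w : V) :
    HasDerivAt (fun t : ℝ => randersNorm A β (y + t • w) ^ 2)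
      (2 * randersNorm A β y * randersNormDeriv A β y w) 0 := by
  have hne : √(A y y) ≠ 0 := (Real.sqrt_pos.2 hy).ne'
  have h1 : HasDerivAt (fun t : ℝ => √(A (y + t • w) (y + t • w)))
      (2 * A y w / (2 * √(A y y))) 0 := by
    simpa using (hasDerivAt_quadratic_line hA y w).sqrt (by simpa using hy.ne')
  refine ((h1.add (hasDerivAt_linear_line β y w)).pow 2).congr_deriv ?_
  simp only [randersNorm, randersNormDeriv, zero_smul, add_zero, Nat.cast_ofNat,
    Nat.add_one_sub_one, pow_one, Pi.add_apply]
  field_simp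

/-- The value of the fundamental tensor of a Randers norm. -/
def randersTensor (A : V →ₗ[ℝ] V →ₗ[ℝ] ℝ) (β : V →ₗ[ℝ] ℝ) (y u v : V) : ℝ :=
  randersNorm A β y * ((A u v - A y u * A y v / A y y) / √(A y y))
    + randersNormDeriv A β y u * randersNormDeriv A β y v

theorem fundamentalTensor_randersNorm (hA : ∀ u w, A u w = A w u) {y : V} (hy : 0 < A y y)
    (u v : V) :
    fundamentalTensor (randersNorm A β) y u v = randersTensor A β y u v := by
  have hQ := hasDerivAt_quadratic_line hA y u
  have hev : ∀ᶠ s : ℝ in nhds 0, 0 < A (y + s • u) (y + s • u) :=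
    hQ.continuousAt.eventually (lt_mem_nhds (by simpa using hy))
  have heq : (fun s : ℝ => deriv (fun t : ℝ => randersNorm A β (y + s • u + t • v) ^ 2) 0)
      =ᶠ[nhds 0] fun s => 2 * (√(A (y + s • u) (y + s • u)) + β (y + s • u))
        * (A (y + s • u) v / √(A (y + s • u) (y + s • u)) + β v) := by
    filter_upwards [hev] with s hs
    exact (hasDerivAt_randersNorm_sq hA hs v).deriv
  have hM : HasDerivAt (fun s : ℝ => A (y + s • u) v) (A u v) 0 :=
    hasDerivAt_linear_line (A.flip v) y u
  have hd := hasDerivAt_randers_mul hQ (hasDerivAt_linear_line β y u) hM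
    (hasDerivAt_const 0 (β v)) (by simpa using hy)
  rw [fundamentalTensor, heq.deriv_eq, hd.deriv]
  have hne : √(A y y) ≠ 0 := (Real.sqrt_pos.2 hy).ne'
  have hne' := hy.ne'
  simp only [zero_smul, add_zero, randersTensor, randersNorm, randersNormDeriv]
  field_simp
  ring

/-- Euler's relation for a function homogeneous of degree one: the angular part of the tensor
annihilates y. -/
theorem randersTensor_self_right {y : V} (hA : ∀ u w, A u w = A w u) (hy : 0 < A y y) (u : V) :
    randersTensor A β y u y = randersNorm A β y * randersNormDeriv A β y u := by
  have hne := hy.ne'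
  have h2 : randersNormDeriv A β y y = randersNorm A β y := by
    simp only [randersNorm, randersNormDeriv, Real.div_sqrt]
  have h3 : A y u * A y y / A y y = A y u := by field_simp
  rw [randersTensor, h2, h3, hA u y]
  ring

/-- The fundamental tensor of a Randers norm whose linear form is dual to `X`, at `X`. -/
theorem randersTensor_dual {X : V} (hX : 0 < A X X) {b : ℝ} (hb : b = √(A X X)) (u v : V) :
    randersTensor A (A X) X u v = (1 + b) * A u v + (1 + b) / b * (A X u * A X v) := by
  have hb0 : 0 < b := hb ▸ Real.sqrt_pos.2 hX
  have hsq : A X X = b ^ 2 := by rw [hb, Real.sq_sqrt hX.le]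
  simp only [randersTensor, randersNorm, randersNormDeriv, hsq, Real.sqrt_sq hb0.le]
  field_simp
  ring

theorem sq_apply_le_of_pos (hA : ∀ u w, A u w = A w u) (hpos : ∀ u, u ≠ 0 → 0 < A u u)
    (u w : V) : A u w ^ 2 ≤ A u u * A w w := by
  by_cases hu : u = 0
  · simp [hu]
  have hu' := hpos u hu
  have hnn : ∀ z, 0 ≤ A z z := fun z => by
    by_cases hz : z = 0
    · simp [hz]
    · exact (hpos z hz).le
  -- Cauchy-Schwarz: this is A(u, u) times the component of w orthogonal to u.
  have h := hnn (A u u • w - A u w • u)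
  simp only [map_sub, map_smul, LinearMap.sub_apply, LinearMap.smul_apply, smul_eq_mul,
    hA w u] at h
  have h' : 0 ≤ A u u * (A u u * A w w - A u w ^ 2) := by linarith
  linarith [nonneg_of_mul_nonneg_right h' hu']

theorem randersNorm_pos {y : V} (hβ : β y ^ 2 < A y y) : 0 < randersNorm A β y := by
  have h := Real.sqrt_lt_sqrt (sq_nonneg _) hβ
  rw [Real.sqrt_sq_eq_abs] at h
  have := neg_abs_le (β y)
  unfold randersNorm
  linarith

/-- Nondegeneracy. Pairing with y kills the derivative of the norm along u; the remaining angular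
part is positive definite modulo y, so u is a multiple cy; then c times the norm of y vanishes. -/
theorem eq_zero_of_randersTensor (hA : ∀ u w, A u w = A w u) (hpos : ∀ u, u ≠ 0 → 0 < A u u)
    {y : V} (hy : y ≠ 0) (hβ : β y ^ 2 < A y y) {u : V}
    (hu : ∀ w, randersTensor A β y u w = 0) : u = 0 := by
  have hL := randersNorm_pos hβ
  have hq := hpos y hy
  have hs := Real.sqrt_pos.2 hq
  have h1 : randersNormDeriv A β y u = 0 := by
    have := hu y
    rw [randersTensor_self_right hA hq] at this
    exact (mul_eq_zero.1 this).resolve_left hL.ne'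
  have h2 : ∀ w, A (u - (A y u / A y y) • y) w = 0 := by
    intro w
    have := hu w
    rw [randersTensor, h1, zero_mul, add_zero] at this
    have := (div_eq_zero_iff.1 ((mul_eq_zero.1 this).resolve_left hL.ne')).resolve_right hs.ne'
    simp only [map_sub, map_smul, LinearMap.sub_apply, LinearMap.smul_apply, smul_eq_mul]
    rw [← this]; ring
  have h3 : u = (A y u / A y y) • y := by
    by_contra hne
    exact (hpos _ (sub_ne_zero.2 hne)).ne' (h2 _)
  have h4 : randersNormDeriv A β y u = (A y u / A y y) * randersNorm A β y := by
    conv_lhs => rw [h3]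
    simp only [randersNormDeriv, randersNorm, map_smul, smul_eq_mul, mul_div_assoc, Real.div_sqrt]
    ring
  rw [h4] at h1
  rw [h3, (mul_eq_zero.1 h1).resolve_right hL.ne', zero_smul]

end VectorSpace

/-! ### Pointwise algebra of the spray and of parallel forms. -/

section SprayAlgebra

variable {V : Type*} [AddCommGroup V] [Module ℝ V] {A : V →ₗ[ℝ] V →ₗ[ℝ] ℝ} {β : V →ₗ[ℝ] ℝ}
  {dA : V →ₗ[ℝ] V →ₗ[ℝ] V →ₗ[ℝ] ℝ} {dβ : V →ₗ[ℝ] V →ₗ[ℝ] ℝ}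

theorem isLinearMap_randersNormDeriv (A : V →ₗ[ℝ] V →ₗ[ℝ] ℝ) (β : V →ₗ[ℝ] ℝ) (y : V) :
    IsLinearMap ℝ (randersNormDeriv A β y) where
  map_add u w := by simp only [randersNormDeriv, map_add]; ring
  map_smul c u := by simp only [randersNormDeriv, map_smul, smul_eq_mul]; ring

theorem isLinearMap_randersTensor (A : V →ₗ[ℝ] V →ₗ[ℝ] ℝ) (β : V →ₗ[ℝ] ℝ) (y u : V) :
    IsLinearMap ℝ (randersTensor A β y u) where
  map_add v w := by simp only [randersTensor, randersNormDeriv, map_add]; ring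
  map_smul c v := by simp only [randersTensor, randersNormDeriv, map_smul, smul_eq_mul]; ring

theorem randersTensor_comm (hA : ∀ u w, A u w = A w u) (y u v : V) :
    randersTensor A β y u v = randersTensor A β y v u := by
  simp only [randersTensor, hA u v]; ring

/-- The derivative of a family of Randers norms in the direction `d` of the base, where the metric
and the form have the derivatives `dA` and `dβ`. -/
def baseDeriv (A : V →ₗ[ℝ] V →ₗ[ℝ] ℝ) (dA : V →ₗ[ℝ] V →ₗ[ℝ] V →ₗ[ℝ] ℝ)
    (dβ : V →ₗ[ℝ] V →ₗ[ℝ] ℝ) (y d : V) : ℝ :=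
  dA d y y / (2 * √(A y y)) + dβ d y

/-- The mixed derivative of a family of Randers norms in the direction `d` of the base and the
direction `w` of the fibre. -/
def mixedDeriv (A : V →ₗ[ℝ] V →ₗ[ℝ] ℝ) (dA : V →ₗ[ℝ] V →ₗ[ℝ] V →ₗ[ℝ] ℝ)
    (dβ : V →ₗ[ℝ] V →ₗ[ℝ] ℝ) (y d w : V) : ℝ :=
  dA d y w / √(A y y) - A y w * dA d y y / (2 * A y y * √(A y y)) + dβ d w

theorem isLinearMap_baseDeriv (y : V) : IsLinearMap ℝ (baseDeriv A dA dβ y) where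
  map_add u w := by simp only [baseDeriv, map_add, LinearMap.add_apply]; ring
  map_smul c u := by simp only [baseDeriv, map_smul, LinearMap.smul_apply, smul_eq_mul]; ring

theorem isLinearMap_mixedDeriv_left (y w : V) :
    IsLinearMap ℝ (fun d => mixedDeriv A dA dβ y d w) where
  map_add u w := by simp only [mixedDeriv, map_add, LinearMap.add_apply]; ring
  map_smul c u := by simp only [mixedDeriv, map_smul, LinearMap.smul_apply, smul_eq_mul]; ring

theorem isLinearMap_mixedDeriv_right (y d : V) :
    IsLinearMap ℝ (mixedDeriv A dA dβ y d) where
  map_add u w := by simp only [mixedDeriv, map_add]; ring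
  map_smul c u := by simp only [mixedDeriv, map_smul, smul_eq_mul]; ring

theorem mixedDeriv_self {y : V} (hy : 0 < A y y) (d : V) :
    mixedDeriv A dA dβ y d y = baseDeriv A dA dβ y d := by
  have := hy.ne'
  have := (Real.sqrt_pos.2 hy).ne'
  simp only [mixedDeriv, baseDeriv]
  field_simp
  ring

/-- `Γ` gives the Christoffel symbols of the second kind of a metric with value `A` and derivative
`dA`: the geodesic spray of the metric is `Γ(y, y) / 2`. -/
def IsChristoffel (A : V →ₗ[ℝ] V →ₗ[ℝ] ℝ) (dA : V →ₗ[ℝ] V →ₗ[ℝ] V →ₗ[ℝ] ℝ)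
    (Γ : V →ₗ[ℝ] V →ₗ[ℝ] V) : Prop :=
  ∀ y w, A (Γ y y) w = dA y y w - dA w y y / 2

/-- Positivity makes A an isomorphism onto the dual, which raises the index. Only the diagonal Γ(y,
y) is constrained, so Γ need not be symmetric. -/
theorem exists_isChristoffel [FiniteDimensional ℝ V] (hpos : ∀ u, u ≠ 0 → 0 < A u u)
    (dA : V →ₗ[ℝ] V →ₗ[ℝ] V →ₗ[ℝ] ℝ) : ∃ Γ, IsChristoffel A dA Γ := by
  have hinj : Function.Injective A := by
    refine (injective_iff_map_eq_zero A).2 fun u hu => ?_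
    by_contra hne
    simpa [hu] using hpos u hne
  let e : V ≃ₗ[ℝ] (V →ₗ[ℝ] ℝ) :=
    LinearEquiv.ofInjectiveOfFinrankEq A hinj (Subspace.dual_finrank_eq (K := ℝ) (V := V)).symm
  have he : ∀ f, A (e.symm f) = f := fun f => e.apply_symm_apply f
  let T : V →ₗ[ℝ] V →ₗ[ℝ] V →ₗ[ℝ] ℝ :=
    dA + (-1 / 2 : ℝ) • (LinearMap.lflip.toLinearMap ∘ₗ dA.flip)
  refine ⟨T.compr₂ e.symm.toLinearMap, fun y w => ?_⟩
  simp only [LinearMap.compr₂_apply, LinearEquiv.coe_coe, he]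
  simp [T]
  ring

section SprayVector

variable {y G : V} (hA : ∀ u w, A u w = A w u) (hpos : ∀ u, u ≠ 0 → 0 < A u u) (hy : y ≠ 0)
  (hβ : β y ^ 2 < A y y)
  (hG : ∀ w, 4 * randersTensor A β y w G
    = 2 * (baseDeriv A dA dβ y y * randersNormDeriv A β y w
      + randersNorm A β y * mixedDeriv A dA dβ y y w)
      - 2 * randersNorm A β y * baseDeriv A dA dβ y w)

include hA hpos hy hβ hG

/-- The Euler-Lagrange equation contracted with w = y, where both sides acquire the positive factor
L. -/
theorem two_mul_randersNormDeriv_spray :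
    2 * randersNormDeriv A β y G = baseDeriv A dA dβ y y := by
  have hL := randersNorm_pos hβ
  have hq := hpos y hy
  have h2 : randersNormDeriv A β y y = randersNorm A β y := by
    simp only [randersNorm, randersNormDeriv, Real.div_sqrt]
  have h := hG y
  rw [randersTensor_comm hA, randersTensor_self_right hA hq, mixedDeriv_self hq, h2] at h
  refine mul_left_cancel₀ hL.ne' ?_
  linarith

/-- Using the radial equation, the product of first derivatives in the fundamental tensor cancels
and L divides out. The terms in dA assemble into Γ, and of dβ only the antisymmetric part is left.
-/
theorem spray_sub_christoffel {Γ : V →ₗ[ℝ] V →ₗ[ℝ] V} (hΓ : IsChristoffel A dA Γ) (w : V) :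
    A y y * A ((2 : ℝ) • G - Γ y y) w - A y ((2 : ℝ) • G - Γ y y) * A y w
      = A y y * √(A y y) * (dβ y w - dβ w y) := by
  have hL := randersNorm_pos hβ
  have hq := hpos y hy
  have hs := (Real.sqrt_pos.2 hq)
  have hsq : √(A y y) ^ 2 = A y y := Real.sq_sqrt hq.le
  have h1 := two_mul_randersNormDeriv_spray hA hpos hy hβ hG
  have h2 : 2 * ((A w G - A y w * A y G / A y y) / √(A y y))
      = mixedDeriv A dA dβ y y w - baseDeriv A dA dβ y w := by
    have h := hG w
    rw [randersTensor] at h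
    refine mul_left_cancel₀ hL.ne' ?_
    linear_combination h / 2 - randersNormDeriv A β y w * h1
  have hy' := hΓ y y
  have hw := hΓ y w
  simp only [map_sub, map_smul, LinearMap.sub_apply, LinearMap.smul_apply, smul_eq_mul]
  rw [hA y (Γ y y), hw, hy', hA G w]
  simp only [mixedDeriv, baseDeriv] at h2
  have hne := hs.ne'
  have hqne := hq.ne'
  field_simp at h2
  linear_combination h2 / 2

theorem randersNormDeriv_spray_sub_christoffel {Γ : V →ₗ[ℝ] V →ₗ[ℝ] V}
    (hΓ : IsChristoffel A dA Γ) :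
    randersNormDeriv A β y ((2 : ℝ) • G - Γ y y) = dβ y y - β (Γ y y) := by
  have hq := hpos y hy
  have hs := (Real.sqrt_pos.2 hq).ne'
  have h1 := two_mul_randersNormDeriv_spray hA hpos hy hβ hG
  have hy' := hΓ y y
  simp only [randersNormDeriv, baseDeriv, map_sub, map_smul, smul_eq_mul] at h1 ⊢
  rw [hA y (Γ y y), hy']
  field_simp at h1 ⊢
  linarith

end SprayVector

/-- The form `β` is parallel with respect to the Levi-Civita connection of the metric. -/
def IsParallelForm (A : V →ₗ[ℝ] V →ₗ[ℝ] ℝ) (β : V →ₗ[ℝ] ℝ)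
    (dA : V →ₗ[ℝ] V →ₗ[ℝ] V →ₗ[ℝ] ℝ) (dβ : V →ₗ[ℝ] V →ₗ[ℝ] ℝ) : Prop :=
  (∀ u w, dβ u w = dβ w u) ∧
    ∃ Γ, IsChristoffel A dA Γ ∧ ∀ y, dβ y y = β (Γ y y)

/-- The same Γ serves both metrics: the extra term mβ(Γ(y, y))β(w) equals mdβ(y, y)β(w), and the
other new terms cancel by the symmetry of dβ. -/
theorem IsParallelForm.perturb (h : IsParallelForm A β dA dβ) {l m k : ℝ}
    {A' : V →ₗ[ℝ] V →ₗ[ℝ] ℝ} {β' : V →ₗ[ℝ] ℝ}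
    {dA' : V →ₗ[ℝ] V →ₗ[ℝ] V →ₗ[ℝ] ℝ} {dβ' : V →ₗ[ℝ] V →ₗ[ℝ] ℝ}
    (hA' : ∀ u w, A' u w = l * A u w + m * (β u * β w)) (hβ' : ∀ u, β' u = k * β u)
    (hdA' : ∀ d u w, dA' d u w = l * dA d u w + m * (dβ d u * β w + β u * dβ d w))
    (hdβ' : ∀ d u, dβ' d u = k * dβ d u) : IsParallelForm A' β' dA' dβ' := by
  obtain ⟨hs, Γ, hΓ, hp⟩ := h
  refine ⟨fun u w => by rw [hdβ', hdβ', hs], Γ, fun y w => ?_, fun y => ?_⟩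
  · rw [hA', hdA', hdA', hΓ, ← hp, hs w y]; ring
  · rw [hdβ', hβ', hp]

end SprayAlgebra

/-! ### Spray coefficients in coordinates and the Douglas and Berwald criteria at a point. -/

section Coordinates

variable {n : ℕ}

theorem linearMap_eq_sum_single {W : Type*} [AddCommGroup W] [Module ℝ W]
    (f : EuclideanSpace ℝ (Fin n) →ₗ[ℝ] W) (y : EuclideanSpace ℝ (Fin n)) :
    f y = ∑ i, y i • f (EuclideanSpace.single i 1) := by
  conv_lhs => rw [← (EuclideanSpace.basisFun (Fin n) ℝ).sum_repr y]
  simp [map_sum]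

theorem IsLinearMap.eq_sum_single {f : EuclideanSpace ℝ (Fin n) → ℝ} (hf : IsLinearMap ℝ f)
    (y : EuclideanSpace ℝ (Fin n)) :
    f y = ∑ i, f (EuclideanSpace.single i 1) * y i := by
  rw [← IsLinearMap.mk'_apply hf, linearMap_eq_sum_single (IsLinearMap.mk' f hf) y]
  simp [mul_comm]

theorem bilinear_apply_eq_sum
    (Γ : EuclideanSpace ℝ (Fin n) →ₗ[ℝ] EuclideanSpace ℝ (Fin n) →ₗ[ℝ] EuclideanSpace ℝ (Fin n))
    (y : EuclideanSpace ℝ (Fin n)) (i : Fin n) :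
    Γ y y i = ∑ j, ∑ k,
      Γ (EuclideanSpace.single j 1) (EuclideanSpace.single k 1) i * y j * y k := by
  have h : IsLinearMap ℝ (fun u => Γ u y i) := ⟨fun u w => by simp, fun c u => by simp⟩
  rw [h.eq_sum_single y]
  refine Finset.sum_congr rfl fun j _ => ?_
  have h' : IsLinearMap ℝ (fun u => Γ (EuclideanSpace.single j 1) u i) :=
    ⟨fun u w => by simp, fun c u => by simp⟩
  rw [h'.eq_sum_single y, Finset.sum_mul]
  exact Finset.sum_congr rfl fun k _ => by ring

/-- The function `√(a_z(y, y)) + β_z(y)` is a Randers metric at `x`, and `a` and `β` have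
the derivatives `da` and `dβ` there. -/
structure IsRandersAt
    (a : EuclideanSpace ℝ (Fin n) →
      EuclideanSpace ℝ (Fin n) →ₗ[ℝ] EuclideanSpace ℝ (Fin n) →ₗ[ℝ] ℝ)
    (β : EuclideanSpace ℝ (Fin n) → EuclideanSpace ℝ (Fin n) →ₗ[ℝ] ℝ)
    (da : EuclideanSpace ℝ (Fin n) →ₗ[ℝ]
      EuclideanSpace ℝ (Fin n) →ₗ[ℝ] EuclideanSpace ℝ (Fin n) →ₗ[ℝ] ℝ)
    (dβ : EuclideanSpace ℝ (Fin n) →ₗ[ℝ] EuclideanSpace ℝ (Fin n) →ₗ[ℝ] ℝ)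
    (x : EuclideanSpace ℝ (Fin n)) : Prop where
  symm : ∀ z u w, a z u w = a z w u
  pos : ∀ u, u ≠ 0 → 0 < a x u u
  sq_lt : ∀ u, u ≠ 0 → β x u ^ 2 < a x u u
  hasDerivAt_metric : ∀ d u w, HasDerivAt (fun s : ℝ => a (x + s • d) u w) (da d u w) 0
  hasDerivAt_form : ∀ d u, HasDerivAt (fun s : ℝ => β (x + s • d) u) (dβ d u) 0

namespace IsRandersAt

variable {a : EuclideanSpace ℝ (Fin n) →
    EuclideanSpace ℝ (Fin n) →ₗ[ℝ] EuclideanSpace ℝ (Fin n) →ₗ[ℝ] ℝ}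
  {β : EuclideanSpace ℝ (Fin n) → EuclideanSpace ℝ (Fin n) →ₗ[ℝ] ℝ}
  {da : EuclideanSpace ℝ (Fin n) →ₗ[ℝ]
    EuclideanSpace ℝ (Fin n) →ₗ[ℝ] EuclideanSpace ℝ (Fin n) →ₗ[ℝ] ℝ}
  {dβ : EuclideanSpace ℝ (Fin n) →ₗ[ℝ] EuclideanSpace ℝ (Fin n) →ₗ[ℝ] ℝ}
  {x : EuclideanSpace ℝ (Fin n)}

theorem hasDerivAt_base (h : IsRandersAt a β da dβ x) {y : EuclideanSpace ℝ (Fin n)} (hy : y ≠ 0)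
    (d : EuclideanSpace ℝ (Fin n)) :
    HasDerivAt (fun s : ℝ => randersNorm (a (x + s • d)) (β (x + s • d)) y ^ 2)
      (2 * randersNorm (a x) (β x) y * baseDeriv (a x) da dβ y d) 0 := by
  have hq := h.pos y hy
  have h1 : HasDerivAt (fun s : ℝ => √(a (x + s • d) y y)) (da d y y / (2 * √(a x y y))) 0 := by
    simpa using (h.hasDerivAt_metric d y y).sqrt (by simpa using hq.ne')
  refine ((h1.add (h.hasDerivAt_form d y)).pow 2).congr_deriv ?_
  simp only [randersNorm, baseDeriv, zero_smul, add_zero, Nat.cast_ofNat,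
    Nat.add_one_sub_one, pow_one, Pi.add_apply]

theorem hasDerivAt_mixed (h : IsRandersAt a β da dβ x) {y : EuclideanSpace ℝ (Fin n)} (hy : y ≠ 0)
    (d w : EuclideanSpace ℝ (Fin n)) :
    HasDerivAt (fun s : ℝ => deriv
        (fun t : ℝ => randersNorm (a (x + s • d)) (β (x + s • d)) (y + t • w) ^ 2) 0)
      (2 * (baseDeriv (a x) da dβ y d * randersNormDeriv (a x) (β x) y w
        + randersNorm (a x) (β x) y * mixedDeriv (a x) da dβ y d w)) 0 := by
  have hq := h.pos y hy
  have hQ := h.hasDerivAt_metric d y y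
  -- Positivity is assumed at x only; continuity carries it along the line, where the inner
  -- derivative has to be evaluated.
  have hev : ∀ᶠ s : ℝ in nhds 0, 0 < a (x + s • d) y y :=
    hQ.continuousAt.eventually (lt_mem_nhds (by simpa using hq))
  have hd := hasDerivAt_randers_mul hQ (h.hasDerivAt_form d y) (h.hasDerivAt_metric d y w)
    (h.hasDerivAt_form d w) (by simpa using hq)
  simp only [zero_smul, add_zero] at hd
  refine hd.congr_of_eventuallyEq ?_
  filter_upwards [hev] with s hs
  exact (hasDerivAt_randersNorm_sq (h.symm _) hs w).deriv

/-- The spray coefficients of a Randers metric solve the Euler-Lagrange equations. -/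
theorem randersTensor_sprayCoeff (h : IsRandersAt a β da dβ x) {y : EuclideanSpace ℝ (Fin n)}
    (hy : y ≠ 0) (w : EuclideanSpace ℝ (Fin n)) :
    4 * randersTensor (a x) (β x) y w
        (WithLp.toLp 2 (sprayCoeff (fun z => randersNorm (a z) (β z)) x y))
      = 2 * (baseDeriv (a x) da dβ y y * randersNormDeriv (a x) (β x) y w
        + randersNorm (a x) (β x) y * mixedDeriv (a x) da dβ y y w)
        - 2 * randersNorm (a x) (β x) y * baseDeriv (a x) da dβ y w := by
  set L := fun z => randersNorm (a z) (β z) with hL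
  have hq := h.pos y hy
  set E : EuclideanSpace ℝ (Fin n) → ℝ := fun w =>
    2 * (baseDeriv (a x) da dβ y y * randersNormDeriv (a x) (β x) y w
        + randersNorm (a x) (β x) y * mixedDeriv (a x) da dβ y y w)
        - 2 * randersNorm (a x) (β x) y * baseDeriv (a x) da dβ y w with hE
  have hElin : IsLinearMap ℝ E := by
    constructor
    · intro u w
      simp only [hE, (isLinearMap_randersNormDeriv _ _ _).map_add,
        (isLinearMap_mixedDeriv_right _ _).map_add, (isLinearMap_baseDeriv _).map_add]
      ring
    · intro c u
      simp only [hE, (isLinearMap_randersNormDeriv _ _ _).map_smul,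
        (isLinearMap_mixedDeriv_right _ _).map_smul, (isLinearMap_baseDeriv _).map_smul,
        smul_eq_mul]
      ring
  have hM : ∀ i j, fundamentalMatrix L x y i j
      = randersTensor (a x) (β x) y (EuclideanSpace.single i 1) (EuclideanSpace.single j 1) :=
    fun i j => fundamentalTensor_randersNorm (h.symm x) hq _ _
  have hMv : ∀ (u : EuclideanSpace ℝ (Fin n)) (l : Fin n),
      (fundamentalMatrix L x y).mulVec u.ofLp l
        = randersTensor (a x) (β x) y (EuclideanSpace.single l 1) u := by
    intro u l
    rw [(isLinearMap_randersTensor _ _ _ _).eq_sum_single u]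
    simp only [Matrix.mulVec, dotProduct, hM]
  -- The matrix inverse in the spray is genuine, since a kernel vector would contradict the
  -- nondegeneracy of the tensor.
  have hdet : IsUnit (fundamentalMatrix L x y).det := by
    rw [isUnit_iff_ne_zero]
    intro h0
    obtain ⟨u, hu, hu0⟩ := Matrix.exists_mulVec_eq_zero_iff.2 h0
    apply hu
    have : (WithLp.toLp 2 u : EuclideanSpace ℝ (Fin n)) = 0 := by
      refine eq_zero_of_randersTensor (h.symm x) h.pos hy (h.sq_lt y hy) fun w => ?_
      rw [(isLinearMap_randersTensor _ _ _ _).eq_sum_single w]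
      refine Finset.sum_eq_zero fun l _ => ?_
      rw [randersTensor_comm (h.symm x), ← hMv, hu0, Pi.zero_apply, zero_mul]
    simpa using this
  have hS : sprayCoeff L x y = (fundamentalMatrix L x y)⁻¹.mulVec
      (fun l => (1 / 4) * E (EuclideanSpace.single l 1)) := by
    funext i
    simp only [sprayCoeff, Matrix.mulVec, dotProduct]
    rw [Finset.mul_sum]
    refine Finset.sum_congr rfl fun l _ => ?_
    have h1 : ∀ k, deriv (fun s : ℝ => deriv (fun t : ℝ =>
        L (x + s • EuclideanSpace.single k 1) (y + t • EuclideanSpace.single l 1) ^ 2) 0) 0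
        = _ := fun k => (h.hasDerivAt_mixed hy _ _).deriv
    have h2 : deriv (fun s : ℝ => L (x + s • EuclideanSpace.single l 1) y ^ 2) 0 = _ :=
      (h.hasDerivAt_base hy _).deriv
    simp only [h1, h2, hE]
    rw [(isLinearMap_baseDeriv (A := a x) (dA := da) (dβ := dβ) y).eq_sum_single y,
      (isLinearMap_mixedDeriv_left (A := a x) (dA := da) (dβ := dβ) y
        (EuclideanSpace.single l 1)).eq_sum_single y, Finset.sum_mul, Finset.mul_sum,
        ← Finset.sum_add_distrib, Finset.mul_sum]
    rw [← mul_assoc, mul_comm (1 / 4 : ℝ), mul_assoc]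
    congr 3
    exact Finset.sum_congr rfl fun k _ => by ring
  have hbase : ∀ l, 4 * randersTensor (a x) (β x) y (EuclideanSpace.single l 1)
      (WithLp.toLp 2 (sprayCoeff L x y)) = E (EuclideanSpace.single l 1) := by
    intro l
    rw [← hMv, hS, Matrix.mulVec_mulVec, Matrix.mul_nonsing_inv _ hdet, Matrix.one_mulVec]
    ring
  change _ = E w
  rw [hElin.eq_sum_single w, randersTensor_comm (h.symm x),
    (isLinearMap_randersTensor _ _ _ _).eq_sum_single w, Finset.mul_sum]
  refine Finset.sum_congr rfl fun l _ => ?_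
  rw [← hbase l, randersTensor_comm (h.symm x)]
  ring

/-- The angular equation makes the deviation minus its projection on y orthogonal to everything, in
particular to itself. -/
theorem spray_eq_of_closed (h : IsRandersAt a β da dβ x) (hc : ∀ u w, dβ u w = dβ w u)
    {Γ : EuclideanSpace ℝ (Fin n) →ₗ[ℝ] EuclideanSpace ℝ (Fin n) →ₗ[ℝ] EuclideanSpace ℝ (Fin n)}
    {y G : EuclideanSpace ℝ (Fin n)} (hy : y ≠ 0)
    (hG : ∀ w, a x y y * a x ((2 : ℝ) • G - Γ y y) w
      - a x y ((2 : ℝ) • G - Γ y y) * a x y w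
      = a x y y * √(a x y y) * (dβ y w - dβ w y)) :
    (2 : ℝ) • G - Γ y y = (a x y ((2 : ℝ) • G - Γ y y) / a x y y) • y := by
  set D := (2 : ℝ) • G - Γ y y
  have hq := (h.pos y hy).ne'
  by_contra hne
  refine (h.pos _ (sub_ne_zero.2 hne)).ne' ?_
  set u := D - (a x y D / a x y y) • y
  have := hG u
  rw [hc y u, sub_self, mul_zero] at this
  have h2 : a x u u = a x D u - a x y D / a x y y * a x y u := by
    conv_lhs => rw [show a x u = a x (D - (a x y D / a x y y) • y) from rfl]
    simp only [map_sub, map_smul, LinearMap.sub_apply, LinearMap.smul_apply, smul_eq_mul]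
  rw [h2]
  field_simp
  linarith

/-- A Randers metric has Douglas spray coefficients at a point exactly if its form is closed
there. -/
theorem douglas_iff (h : IsRandersAt a β da dβ x) :
    (∃ (Γ : Fin n → Fin n → Fin n → ℝ) (P : EuclideanSpace ℝ (Fin n) → ℝ),
      ∀ y : EuclideanSpace ℝ (Fin n), y ≠ 0 → ∀ i,
        sprayCoeff (fun z => randersNorm (a z) (β z)) x y i
          = (1 / 2) * ∑ j, ∑ k, Γ i j k * y j * y k + P y * y i) ↔
    ∀ u w, dβ u w = dβ w u := by
  obtain ⟨C, hC⟩ := exists_isChristoffel h.pos da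
  have key : ∀ y : EuclideanSpace ℝ (Fin n), y ≠ 0 → _ := fun y hy w =>
    spray_sub_christoffel (h.symm x) h.pos hy (h.sq_lt y hy) (h.randersTensor_sprayCoeff hy) hC w
  constructor
  · rintro ⟨Γ, P, hΓ⟩ u w
    by_cases hu : u = 0
    · simp [hu]
    set Q : EuclideanSpace ℝ (Fin n) → EuclideanSpace ℝ (Fin n) := fun y =>
      WithLp.toLp 2 (fun i => ∑ j, ∑ k, Γ i j k * y j * y k) with hQ
    have hQneg : ∀ y, Q (-y) = Q y := by
      intro y
      simp [hQ]
    have hG : ∀ y : EuclideanSpace ℝ (Fin n), y ≠ 0 →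
        (2 : ℝ) • (WithLp.toLp 2 (sprayCoeff (fun z => randersNorm (a z) (β z)) x y) :
          EuclideanSpace ℝ (Fin n)) = Q y + (2 * P y) • y := by
      intro y hy
      ext i
      simp only [hQ, PiLp.add_apply, PiLp.smul_apply, smul_eq_mul]
      rw [hΓ y hy i]
      ring
    -- The left side of `key` is blind to multiples of y, so P drops out and the rest is even in y.
    -- The right side is odd, hence zero.
    have hu1 := key u hu w
    have hu2 := key (-u) (neg_ne_zero.2 hu) w
    rw [hG u hu] at hu1
    rw [hG (-u) (neg_ne_zero.2 hu), hQneg] at hu2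
    simp only [map_neg, LinearMap.neg_apply, neg_neg, map_sub, map_add, LinearMap.sub_apply,
      LinearMap.add_apply, map_smul, LinearMap.smul_apply, smul_eq_mul] at hu1 hu2
    have hq := h.pos u hu
    have h0 : (a x u u * √(a x u u)) * (dβ u w - dβ w u) = 0 := by linarith
    have := (mul_eq_zero.1 h0).resolve_left (mul_pos hq (Real.sqrt_pos.2 hq)).ne'
    linarith
  · intro hc
    refine ⟨fun i j k => C (EuclideanSpace.single j 1) (EuclideanSpace.single k 1) i, fun y =>
      a x y ((2 : ℝ) • (WithLp.toLp 2 (sprayCoeff (fun z => randersNorm (a z) (β z)) x y) :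
          EuclideanSpace ℝ (Fin n)) - C y y) / a x y y / 2, fun y hy i => ?_⟩
    have := congrArg (fun u : EuclideanSpace ℝ (Fin n) => u i)
      (h.spray_eq_of_closed hc hy (key y hy))
    simp only [PiLp.sub_apply, PiLp.smul_apply, smul_eq_mul] at this
    rw [← bilinear_apply_eq_sum]
    linarith

/-- A Randers metric has Berwald spray coefficients at a point exactly if its form is parallel
there. -/
theorem berwald_iff (h : IsRandersAt a β da dβ x) :
    (∃ (Γ : Fin n → Fin n → Fin n → ℝ),
      ∀ y : EuclideanSpace ℝ (Fin n), y ≠ 0 → ∀ i,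
        sprayCoeff (fun z => randersNorm (a z) (β z)) x y i
          = (1 / 2) * ∑ j, ∑ k, Γ i j k * y j * y k) ↔
    IsParallelForm (a x) (β x) da dβ := by
  have key : ∀ C, IsChristoffel (a x) da C → ∀ y : EuclideanSpace ℝ (Fin n), y ≠ 0 → _ :=
    fun C hC y hy w => spray_sub_christoffel (h.symm x) h.pos hy (h.sq_lt y hy)
      (h.randersTensor_sprayCoeff hy) hC w
  have key' : ∀ C, IsChristoffel (a x) da C → ∀ y : EuclideanSpace ℝ (Fin n), y ≠ 0 → _ :=
    fun C hC y hy => randersNormDeriv_spray_sub_christoffel (h.symm x) h.pos hy (h.sq_lt y hy)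
      (h.randersTensor_sprayCoeff hy) hC
  have hself : ∀ y, randersNormDeriv (a x) (β x) y y = √(a x y y) + β x y := by
    intro y
    simp only [randersNormDeriv, Real.div_sqrt]
  constructor
  · rintro ⟨Γ, hΓ⟩
    have hc : ∀ u w, dβ u w = dβ w u :=
      h.douglas_iff.1 ⟨Γ, 0, fun y hy i => by simpa using hΓ y hy i⟩
    obtain ⟨C, hC⟩ := exists_isChristoffel h.pos da
    refine ⟨hc, C, hC, fun y => ?_⟩
    by_cases hy : y = 0
    · simp [hy]
    set Q : EuclideanSpace ℝ (Fin n) → EuclideanSpace ℝ (Fin n) := fun y =>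
      WithLp.toLp 2 (fun i => ∑ j, ∑ k, Γ i j k * y j * y k) with hQ
    have hQneg : ∀ y, Q (-y) = Q y := by
      intro y
      simp [hQ]
    have hG : ∀ y : EuclideanSpace ℝ (Fin n), y ≠ 0 →
        (2 : ℝ) • (WithLp.toLp 2 (sprayCoeff (fun z => randersNorm (a z) (β z)) x y) :
          EuclideanSpace ℝ (Fin n)) = Q y := by
      intro y hy
      ext i
      simp only [hQ, PiLp.smul_apply, smul_eq_mul]
      rw [hΓ y hy i]
      ring
    have hy' := neg_ne_zero.2 hy
    have e1 := h.spray_eq_of_closed hc hy (key C hC y hy)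
    have r1 := key' C hC y hy
    have e2 := h.spray_eq_of_closed hc hy' (key C hC _ hy')
    have r2 := key' C hC _ hy'
    rw [hG y hy] at e1 r1
    rw [hG _ hy', hQneg] at e2 r2
    simp only [map_neg, LinearMap.neg_apply, neg_neg] at e2 r2
    set D := Q y - C y y
    set l := a x y D / a x y y
    -- D is even in y, so its factor along −y is −l. The radial equations at y and −y have the same
    -- right side, and subtracting them leaves 2l√A(y, y) = 0.
    have e2' : D = -l • (-y) := by rw [e2, neg_div]
    have s1 : l * (√(a x y y) + β x y) = dβ y y - β x (C y y) := by
      rw [← r1, e1, (isLinearMap_randersNormDeriv _ _ _).map_smul, hself, smul_eq_mul]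
    have s2 : -l * (√(a x y y) - β x y) = dβ y y - β x (C y y) := by
      rw [← r2, e2', (isLinearMap_randersNormDeriv _ _ _).map_smul, hself, smul_eq_mul]
      simp [sub_eq_add_neg]
    have hs := Real.sqrt_pos.2 (h.pos y hy)
    have hl : l = 0 := by
      have : l * √(a x y y) = 0 := by linarith
      exact (mul_eq_zero.1 this).resolve_right hs.ne'
    rw [hl, zero_mul] at s1
    linarith
  · rintro ⟨hc, C, hC, hp⟩
    refine ⟨fun i j k => C (EuclideanSpace.single j 1) (EuclideanSpace.single k 1) i,
      fun y hy i => ?_⟩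
    have e1 := h.spray_eq_of_closed hc hy (key C hC y hy)
    have r1 := key' C hC y hy
    have hL := randersNorm_pos (h.sq_lt y hy)
    -- For a parallel form the radial equation says that the factor along y times the positive norm
    -- of y is zero, so the spray is that of A.
    rw [e1, (isLinearMap_randersNormDeriv _ _ _).map_smul, hself, smul_eq_mul, hp, sub_self] at r1
    rw [(mul_eq_zero.1 r1).resolve_right hL.ne', zero_smul] at e1
    have := congrArg (fun u : EuclideanSpace ℝ (Fin n) => u i) e1
    simp only [PiLp.sub_apply, PiLp.smul_apply, smul_eq_mul, PiLp.zero_apply] at this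
    rw [← bilinear_apply_eq_sum]
    linarith

end IsRandersAt

end Coordinates

/-! ### Differentiating metrics and forms, and changing them by constants. -/

section Coordinates

variable {n : ℕ}

theorem exists_hasDerivAt_form {β : EuclideanSpace ℝ (Fin n) → EuclideanSpace ℝ (Fin n) →ₗ[ℝ] ℝ}
    {x : EuclideanSpace ℝ (Fin n)} (h : ∀ u, DifferentiableAt ℝ (fun z => β z u) x) :
    ∃ dβ : EuclideanSpace ℝ (Fin n) →ₗ[ℝ] EuclideanSpace ℝ (Fin n) →ₗ[ℝ] ℝ,
      ∀ d u, HasDerivAt (fun s : ℝ => β (x + s • d) u) (dβ d u) 0 := by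
  refine ⟨LinearMap.mk₂ ℝ (fun d u => fderiv ℝ (fun z => β z u) x d) (fun d d' u => by simp)
    (fun c d u => by simp) (fun d u u' => ?_) (fun c d u => ?_), fun d u => ?_⟩
  · simp only [map_add]
    rw [fderiv_fun_add (h u) (h u')]
    rfl
  · simp only [map_smul]
    rw [fderiv_fun_const_smul (h u)]
    rfl
  · exact (h u).hasFDerivAt.hasLineDerivAt d

theorem exists_hasDerivAt_metric
    {a : EuclideanSpace ℝ (Fin n) →
      EuclideanSpace ℝ (Fin n) →ₗ[ℝ] EuclideanSpace ℝ (Fin n) →ₗ[ℝ] ℝ}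
    {x : EuclideanSpace ℝ (Fin n)} (h : ∀ u w, DifferentiableAt ℝ (fun z => a z u w) x) :
    ∃ da : EuclideanSpace ℝ (Fin n) →ₗ[ℝ]
        EuclideanSpace ℝ (Fin n) →ₗ[ℝ] EuclideanSpace ℝ (Fin n) →ₗ[ℝ] ℝ,
      ∀ d u w, HasDerivAt (fun s : ℝ => a (x + s • d) u w) (da d u w) 0 := by
  choose D hD using fun u => exists_hasDerivAt_form (β := fun z => a z u) (x := x) (h u)
  refine ⟨LinearMap.mk₂ ℝ (fun d u => D u d) (fun d d' u => by simp)
    (fun c d u => by simp) (fun d u u' => ?_) (fun c d u => ?_), fun d u w => hD u d w⟩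
  · ext w
    refine (hD (u + u') d w).unique ?_
    simp only [map_add, LinearMap.add_apply]
    exact (hD u d w).add (hD u' d w)
  · ext w
    refine (hD (c • u) d w).unique ?_
    simp only [map_smul, LinearMap.smul_apply, smul_eq_mul]
    exact (hD u d w).const_mul c

variable {a a' : EuclideanSpace ℝ (Fin n) →
    EuclideanSpace ℝ (Fin n) →ₗ[ℝ] EuclideanSpace ℝ (Fin n) →ₗ[ℝ] ℝ}
  {β β' : EuclideanSpace ℝ (Fin n) → EuclideanSpace ℝ (Fin n) →ₗ[ℝ] ℝ}
  {x : EuclideanSpace ℝ (Fin n)}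
  {da : EuclideanSpace ℝ (Fin n) →ₗ[ℝ]
    EuclideanSpace ℝ (Fin n) →ₗ[ℝ] EuclideanSpace ℝ (Fin n) →ₗ[ℝ] ℝ}
  {dβ : EuclideanSpace ℝ (Fin n) →ₗ[ℝ] EuclideanSpace ℝ (Fin n) →ₗ[ℝ] ℝ}

/-- If `g = (1 + b)(a + β² / b)`, where `b` is the norm of `β`, then `(1 + b)²β` has norm less than
one with respect to `g` and the derivatives of `g` are given by the product rule. -/
theorem IsRandersAt.perturb (h : IsRandersAt a β da dβ x) {b : ℝ} (hb : 0 < b)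
    (hβ : ∀ u, β x u ^ 2 ≤ b ^ 2 * a x u u) (hb1 : (1 + b) * b < 1)
    (ha' : ∀ z u w, a' z u w = (1 + b) * a z u w + (1 + b) / b * (β z u * β z w))
    (hβ' : ∀ z u, β' z u = (1 + b) ^ 2 * β z u) :
    ∃ da' dβ', IsRandersAt a' β' da' dβ' x ∧
      (∀ d u w, da' d u w
        = (1 + b) * da d u w + (1 + b) / b * (dβ d u * β x w + β x u * dβ d w)) ∧
      ∀ d u, dβ' d u = (1 + b) ^ 2 * dβ d u := by
  have hda : ∀ d u w, HasDerivAt (fun s : ℝ => a' (x + s • d) u w)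
      ((1 + b) * da d u w + (1 + b) / b * (dβ d u * β x w + β x u * dβ d w)) 0 := by
    intro d u w
    simp only [ha']
    have := ((h.hasDerivAt_metric d u w).const_mul (1 + b)).add
      (((h.hasDerivAt_form d u).mul (h.hasDerivAt_form d w)).const_mul ((1 + b) / b))
    simp only [zero_smul, add_zero] at this
    exact this
  have hdβ : ∀ d u, HasDerivAt (fun s : ℝ => β' (x + s • d) u) ((1 + b) ^ 2 * dβ d u) 0 := by
    intro d u
    simp only [hβ']
    exact (h.hasDerivAt_form d u).const_mul _
  let B : EuclideanSpace ℝ (Fin n) →ₗ[ℝ] EuclideanSpace ℝ (Fin n) →ₗ[ℝ]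
      EuclideanSpace ℝ (Fin n) →ₗ[ℝ] ℝ := LinearMap.mk₂ ℝ
    (fun d u => (1 + b) • da d u + ((1 + b) / b) • (dβ d u • β x + β x u • dβ d))
    (fun d d' u => by ext w; simp; ring) (fun c d u => by ext w; simp; ring)
    (fun d u u' => by ext w; simp; ring) (fun c d u => by ext w; simp; ring)
  refine ⟨B, (1 + b) ^ 2 • dβ, ⟨fun z u w => ?_, fun u hu => ?_, fun u hu => ?_, fun d u w => ?_,
    fun d u => hdβ d u⟩, fun d u w => ?_, fun d u => rfl⟩
  · rw [ha', ha', h.symm z u w, mul_comm (β z u)]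
  · rw [ha']
    have := h.pos u hu
    have := mul_self_nonneg (β x u)
    positivity
  · rw [ha', hβ']
    have hq := h.pos u hu
    -- The strict step of the estimate below needs β(u) ≠ 0; otherwise positivity of the metric
    -- suffices.
    by_cases h0 : β x u = 0
    · rw [h0]
      simp only [mul_zero, add_zero, ne_eq, OfNat.ofNat_ne_zero, not_false_eq_true, zero_pow]
      positivity
    have hB : 0 < β x u ^ 2 := by positivity
    have h1 : β x u ^ 2 / b ^ 2 ≤ a x u u := by
      rw [div_le_iff₀ (by positivity)]
      linarith [hβ u]
    have h2 : ((1 + b) * b) ^ 2 < 1 := by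
      have : 0 < (1 + b) * b := by positivity
      nlinarith
    calc ((1 + b) ^ 2 * β x u) ^ 2
        = ((1 + b) * b) ^ 2 * ((1 + b) ^ 2 * β x u ^ 2 / b ^ 2) := by field_simp
      _ < 1 * ((1 + b) ^ 2 * β x u ^ 2 / b ^ 2) := by gcongr
      _ = (1 + b) * (β x u ^ 2 / b ^ 2) + (1 + b) / b * (β x u * β x u) := by
          field_simp
      _ ≤ (1 + b) * a x u u + (1 + b) / b * (β x u * β x u) := by gcongr
  · convert hda d u w using 1
    simp [B]
    ring
  · simp [B]
    ring

/-- The change has an inverse of the same shape: A = A'/l − (m/(lk²)) β' ⊗ β' and β = β'/k. -/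
theorem isParallelForm_perturb_iff {A A' : EuclideanSpace ℝ (Fin n) →ₗ[ℝ]
      EuclideanSpace ℝ (Fin n) →ₗ[ℝ] ℝ} {β β' : EuclideanSpace ℝ (Fin n) →ₗ[ℝ] ℝ}
    {da da' : EuclideanSpace ℝ (Fin n) →ₗ[ℝ]
      EuclideanSpace ℝ (Fin n) →ₗ[ℝ] EuclideanSpace ℝ (Fin n) →ₗ[ℝ] ℝ}
    {dβ dβ' : EuclideanSpace ℝ (Fin n) →ₗ[ℝ] EuclideanSpace ℝ (Fin n) →ₗ[ℝ] ℝ} {l m k : ℝ}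
    (hl : l ≠ 0) (hk : k ≠ 0)
    (hA' : ∀ u w, A' u w = l * A u w + m * (β u * β w)) (hβ' : ∀ u, β' u = k * β u)
    (hdA' : ∀ d u w, da' d u w = l * da d u w + m * (dβ d u * β w + β u * dβ d w))
    (hdβ' : ∀ d u, dβ' d u = k * dβ d u) :
    IsParallelForm A β da dβ ↔ IsParallelForm A' β' da' dβ' := by
  refine ⟨fun h => h.perturb hA' hβ' hdA' hdβ', fun h =>
    h.perturb (l := 1 / l) (m := -(m / (l * k ^ 2))) (k := 1 / k) (fun u w => ?_) (fun u => ?_)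
      (fun d u w => ?_) (fun d u => ?_)⟩
  · rw [hA', hβ', hβ']; field_simp; ring
  · rw [hβ']; field_simp
  · rw [hdA', hβ', hβ', hdβ', hdβ']; field_simp; ring
  · rw [hdβ']; field_simp

end Coordinates

/-! ### From the manifold to charts. -/

section Manifold

variable {n : ℕ} {M : Type*} [TopologicalSpace M] [ChartedSpace (EuclideanSpace ℝ (Fin n)) M]

/-- No regularity of Γ in x is demanded, so the condition can be checked one point at a time. -/
theorem isBerwaldType_iff {F : ∀ p : M, TangentSpace (𝓡 n) p → ℝ} :
    IsBerwaldType F ↔ ∀ e ∈ IsManifold.maximalAtlas (𝓡 n) ∞ M, ∀ x ∈ e.target,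
      ∃ Γ : Fin n → Fin n → Fin n → ℝ, ∀ y : EuclideanSpace ℝ (Fin n), y ≠ 0 → ∀ i,
        sprayCoeff (localExpression F e) x y i = (1 / 2) * ∑ j, ∑ k, Γ i j k * y j * y k := by
  refine forall₂_congr fun e _ => ⟨fun ⟨Γ, h⟩ x hx => ⟨Γ x, h x hx⟩, fun h => ?_⟩
  choose! Γ hΓ using h
  exact ⟨Γ, hΓ⟩

theorem isDouglasType_iff {F : ∀ p : M, TangentSpace (𝓡 n) p → ℝ} :
    IsDouglasType F ↔ ∀ e ∈ IsManifold.maximalAtlas (𝓡 n) ∞ M, ∀ x ∈ e.target,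
      ∃ (Γ : Fin n → Fin n → Fin n → ℝ) (P : EuclideanSpace ℝ (Fin n) → ℝ),
        ∀ y : EuclideanSpace ℝ (Fin n), y ≠ 0 → ∀ i,
          sprayCoeff (localExpression F e) x y i
            = (1 / 2) * ∑ j, ∑ k, Γ i j k * y j * y k + P y * y i := by
  refine forall₂_congr fun e _ => ⟨fun ⟨Γ, P, h⟩ x hx => ⟨Γ x, P x, h x hx⟩, fun h => ?_⟩
  choose! Γ P hΓ using h
  exact ⟨Γ, P, hΓ⟩

theorem mfderiv_chart_symm_injective {e : OpenPartialHomeomorph M (EuclideanSpace ℝ (Fin n))}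
    (he : e ∈ IsManifold.maximalAtlas (𝓡 n) ∞ M) {x : EuclideanSpace ℝ (Fin n)}
    (hx : x ∈ e.target) : Function.Injective (mfderiv (𝓡 n) (𝓡 n) e.symm x) := by
  have h1 : MDifferentiableAt (𝓡 n) (𝓡 n) e.symm x :=
    (contMDiffAt_symm_of_mem_maximalAtlas he hx).mdifferentiableAt (by simp)
  have h2 : MDifferentiableAt (𝓡 n) (𝓡 n) e (e.symm x) :=
    (contMDiffAt_of_mem_maximalAtlas he (e.map_target hx)).mdifferentiableAt (by simp)
  have h3 := mfderiv_comp x h2 h1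
  have h4 : (e ∘ e.symm) =ᶠ[nhds x] id := by
    filter_upwards [e.open_target.mem_nhds hx] with z hz using e.right_inv hz
  rw [h4.mfderiv_eq, mfderiv_id] at h3
  have h5 : Function.LeftInverse (mfderiv (𝓡 n) (𝓡 n) e (e.symm x))
      (mfderiv (𝓡 n) (𝓡 n) e.symm x) := fun u => (DFunLike.congr_fun h3 u).symm
  exact h5.injective

variable [IsManifold (𝓡 n) ∞ M]

/-- Coordinate vector fields are differentiable: they are the tangent map of the inverse chart
applied to a constant field. This makes the coefficients of the metric and the form differentiable.
-/
theorem mdifferentiableAt_mfderiv_chart_symm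
    {e : OpenPartialHomeomorph M (EuclideanSpace ℝ (Fin n))}
    (he : e ∈ IsManifold.maximalAtlas (𝓡 n) ∞ M) {x : EuclideanSpace ℝ (Fin n)}
    (hx : x ∈ e.target) (u : EuclideanSpace ℝ (Fin n)) :
    MDifferentiableAt (𝓡 n) ((𝓡 n).prod (𝓡 n)) (fun z =>
      (Bundle.TotalSpace.mk' (EuclideanSpace ℝ (Fin n)) (e.symm z)
        (mfderiv (𝓡 n) (𝓡 n) e.symm z u) : TangentBundle (𝓡 n) M)) x := by
  have : IsManifold (𝓡 n) 1 M := IsManifold.of_le (n := ∞) (by simp)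
  have h1 := (contMDiffOn_symm_of_mem_maximalAtlas he).contMDiffOn_tangentMapWithin (m := 1)
    (by norm_num; exact ENat.LEInfty.out) (e.open_target.uniqueMDiffOn (I := 𝓡 n))
  have h2 : ContMDiff (𝓡 n) (𝓡 n).tangent 1 (fun z : EuclideanSpace ℝ (Fin n) =>
      (Bundle.TotalSpace.mk' (EuclideanSpace ℝ (Fin n)) z u :
        TangentBundle (𝓡 n) (EuclideanSpace ℝ (Fin n)))) :=
    contMDiff_vectorSpace_iff_contDiff.2 contDiff_const
  have h3 : ContMDiffOn (𝓡 n) (𝓡 n).tangent 1 (fun z =>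
      (Bundle.TotalSpace.mk' (EuclideanSpace ℝ (Fin n)) (e.symm z)
        (mfderiv (𝓡 n) (𝓡 n) e.symm z u) : TangentBundle (𝓡 n) M)) e.target := by
    refine (h1.comp h2.contMDiffOn fun z hz => hz).congr fun z hz => ?_
    simp only [Function.comp_apply, tangentMapWithin]
    rw [mfderivWithin_of_isOpen e.open_target hz]
  exact (h3.contMDiffAt (e.open_target.mem_nhds hx)).mdifferentiableAt (by simp)

/-- The inner product `h` at a point as a bilinear form. -/
def innerAt (h : Bundle.ContMDiffRiemannianMetric (𝓡 n) ∞ (EuclideanSpace ℝ (Fin n))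
    (fun p : M => TangentSpace (𝓡 n) p)) (p : M) :
    TangentSpace (𝓡 n) p →ₗ[ℝ] TangentSpace (𝓡 n) p →ₗ[ℝ] ℝ :=
  LinearMap.mk₂ ℝ (fun u w => h.inner p u w)
    (fun u u' w => by simp only [map_add]; rfl) (fun c u w => by simp only [map_smul]; rfl)
    (fun u w w' => by simp only [map_add]) (fun c u w => by simp only [map_smul])

/-- The metric `h` in the coordinates of the chart `e`. -/
def chartMetric (h : Bundle.ContMDiffRiemannianMetric (𝓡 n) ∞ (EuclideanSpace ℝ (Fin n))
      (fun p : M => TangentSpace (𝓡 n) p))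
    (e : OpenPartialHomeomorph M (EuclideanSpace ℝ (Fin n))) (z : EuclideanSpace ℝ (Fin n)) :
    EuclideanSpace ℝ (Fin n) →ₗ[ℝ] EuclideanSpace ℝ (Fin n) →ₗ[ℝ] ℝ :=
  (innerAt h (e.symm z)).compl₁₂ (mfderiv (𝓡 n) (𝓡 n) e.symm z).toLinearMap
    (mfderiv (𝓡 n) (𝓡 n) e.symm z).toLinearMap

/-- The form `h(X, ·)` in the coordinates of the chart `e`. -/
def chartForm (h : Bundle.ContMDiffRiemannianMetric (𝓡 n) ∞ (EuclideanSpace ℝ (Fin n))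
      (fun p : M => TangentSpace (𝓡 n) p)) (X : ∀ p : M, TangentSpace (𝓡 n) p)
    (e : OpenPartialHomeomorph M (EuclideanSpace ℝ (Fin n))) (z : EuclideanSpace ℝ (Fin n)) :
    EuclideanSpace ℝ (Fin n) →ₗ[ℝ] ℝ :=
  ((h.inner (e.symm z) (X (e.symm z))).comp (mfderiv (𝓡 n) (𝓡 n) e.symm z)).toLinearMap

variable {h : Bundle.ContMDiffRiemannianMetric (𝓡 n) ∞ (EuclideanSpace ℝ (Fin n))
      (fun p : M => TangentSpace (𝓡 n) p)} {X : ∀ p : M, TangentSpace (𝓡 n) p}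
  {e : OpenPartialHomeomorph M (EuclideanSpace ℝ (Fin n))} {x : EuclideanSpace ℝ (Fin n)}

theorem inner_sq_le (p : M) (u w : TangentSpace (𝓡 n) p) :
    h.inner p u w ^ 2 ≤ h.inner p u u * h.inner p w w :=
  sq_apply_le_of_pos (A := innerAt h p) (h.symm p) (h.pos p) u w

theorem differentiableAt_inner
    {Y Z : ∀ z : EuclideanSpace ℝ (Fin n), TangentSpace (𝓡 n) (e.symm z)}
    (he : MDifferentiableAt (𝓡 n) (𝓡 n) e.symm x)
    (hY : MDifferentiableAt (𝓡 n) ((𝓡 n).prod (𝓡 n)) (fun z =>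
      (Bundle.TotalSpace.mk' (EuclideanSpace ℝ (Fin n)) (e.symm z) (Y z) :
        TangentBundle (𝓡 n) M)) x)
    (hZ : MDifferentiableAt (𝓡 n) ((𝓡 n).prod (𝓡 n)) (fun z =>
      (Bundle.TotalSpace.mk' (EuclideanSpace ℝ (Fin n)) (e.symm z) (Z z) :
        TangentBundle (𝓡 n) M)) x) :
    DifferentiableAt ℝ (fun z => h.inner (e.symm z) (Y z) (Z z)) x := by
  have : IsManifold (𝓡 n) 1 M := IsManifold.of_le (n := ∞) (by simp)
  have key : MDifferentiableAt (𝓡 n) ((𝓡 n).prod 𝓘(ℝ)) (fun z =>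
      Bundle.TotalSpace.mk' ℝ (E := Bundle.Trivial M ℝ) (e.symm z)
        (h.inner (e.symm z) (Y z) (Z z))) x := by
    apply MDifferentiableAt.clm_bundle_apply₂ (F₁ := EuclideanSpace ℝ (Fin n))
      (F₂ := EuclideanSpace ℝ (Fin n))
    · exact (h.contMDiff.mdifferentiableAt (by simp)).comp x he
    · exact hY
    · exact hZ
  rw [mdifferentiableAt_totalSpace] at key
  exact key.2.differentiableAt

theorem exists_isRandersAt_chart (he : e ∈ IsManifold.maximalAtlas (𝓡 n) ∞ M) (hx : x ∈ e.target)
    (hX : MDifferentiable (𝓡 n) ((𝓡 n).prod (𝓡 n))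
      (fun p => (Bundle.TotalSpace.mk' (EuclideanSpace ℝ (Fin n)) p (X p) : TangentBundle (𝓡 n) M)))
    (h_norm : ∀ p, h.inner p (X p) (X p) < 1) :
    ∃ da dβ, IsRandersAt (chartMetric h e) (chartForm h X e) da dβ x := by
  have h1 : MDifferentiableAt (𝓡 n) (𝓡 n) e.symm x :=
    (contMDiffAt_symm_of_mem_maximalAtlas he hx).mdifferentiableAt (by simp)
  have hD := mdifferentiableAt_mfderiv_chart_symm he hx
  obtain ⟨da, hda⟩ := exists_hasDerivAt_metric (a := chartMetric h e) (x := x)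
    fun u w => differentiableAt_inner h1 (hD u) (hD w)
  obtain ⟨dβ, hdβ⟩ := exists_hasDerivAt_form (β := chartForm h X e) (x := x)
    fun u => differentiableAt_inner (Y := fun z => X (e.symm z)) h1
      ((hX (e.symm x)).comp x h1) (hD u)
  have hpos : ∀ u : EuclideanSpace ℝ (Fin n), u ≠ 0 → 0 < chartMetric h e x u u := by
    intro u hu
    refine h.pos _ _ fun h0 => hu (mfderiv_chart_symm_injective he hx ?_)
    exact h0.trans (map_zero (mfderiv (𝓡 n) (𝓡 n) e.symm x)).symm
  refine ⟨da, dβ, fun z u w => h.symm _ _ _, hpos, fun u hu => ?_, hda, hdβ⟩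
  calc chartForm h X e x u ^ 2
      ≤ h.inner (e.symm x) (X (e.symm x)) (X (e.symm x)) * chartMetric h e x u u :=
        inner_sq_le _ _ _
    _ < 1 * chartMetric h e x u u := mul_lt_mul_of_pos_right (h_norm _) (hpos u hu)
    _ = chartMetric h e x u u := one_mul _

theorem fundamentalTensorAlong_randersMetric {b : ℝ} {p : M} (hX : X p ≠ 0)
    (hb : b = √(h.inner p (X p) (X p))) (u w : TangentSpace (𝓡 n) p) :
    fundamentalTensorAlong (randersMetric (fun p u w => h.inner p u w) X) X p u w
      = (1 + b) * h.inner p u w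
        + (1 + b) / b * (h.inner p (X p) u * h.inner p (X p) w) := by
  have hpos : 0 < innerAt h p (X p) (X p) := h.pos p _ hX
  have h1 := fundamentalTensor_randersNorm (A := innerAt h p) (β := innerAt h p (X p))
    (h.symm p) hpos u w
  rw [randersTensor_dual hpos hb] at h1
  exact h1

end Manifold

/-! ### Constancy of the length of a left-invariant field. -/

section LieGroup

variable {n : ℕ} {G : Type*} [TopologicalSpace G]
    [ChartedSpace (EuclideanSpace ℝ (Fin n)) G] [Group G] [LieGroup (𝓡 n) ∞ G]

theorem inner_mulInvariantVectorField
    {h : Bundle.ContMDiffRiemannianMetric (𝓡 n) ∞ (EuclideanSpace ℝ (Fin n))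
      (fun p : G => TangentSpace (𝓡 n) p)}
    (h_left : IsLeftInvariantMetric (fun (p : G) u v => h.inner p u v))
    (v : GroupLieAlgebra (𝓡 n) G) (p : G) :
    h.inner p (mulInvariantVectorField v p) (mulInvariantVectorField v p) = h.inner 1 v v := by
  -- The tangent spaces at p * 1 and p are different types; generalising the base point to q permits
  -- the transport.
  have key : ∀ q : G, p * 1 = q →
      h.inner (p * 1) (mfderiv (𝓡 n) (𝓡 n) (fun q : G => p * q) 1 v)
        (mfderiv (𝓡 n) (𝓡 n) (fun q : G => p * q) 1 v)
      = h.inner q (mfderiv (𝓡 n) (𝓡 n) (fun q : G => p * q) 1 v :)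
        (mfderiv (𝓡 n) (𝓡 n) (fun q : G => p * q) 1 v :) := by
    rintro q rfl
    rfl
  exact (key p (mul_one p)).symm.trans (h_left p 1 v v)

end LieGroup

end

theorem proposition3p1 {n : ℕ} {G : Type*} [TopologicalSpace G]
    [ChartedSpace (EuclideanSpace ℝ (Fin n)) G] [Group G] [LieGroup (𝓡 n) ∞ G]
    (h : Bundle.ContMDiffRiemannianMetric (𝓡 n) ∞ (EuclideanSpace ℝ (Fin n))
      (fun p : G => TangentSpace (𝓡 n) p))
    (h_left : IsLeftInvariantMetric (fun (p : G) u v => h.inner p u v))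
    (v : GroupLieAlgebra (𝓡 n) G) (hv : v ≠ 0)
    (X : ∀ p : G, TangentSpace (𝓡 n) p) (hX : X = mulInvariantVectorField v)
    (F : ∀ p : G, TangentSpace (𝓡 n) p → ℝ)
    (hF : F = randersMetric (fun p u w => h.inner p u w) X)
    (gX : ∀ p : G, TangentSpace (𝓡 n) p → TangentSpace (𝓡 n) p → ℝ)
    (hgX : gX = fundamentalTensorAlong F X)
    (F' : ∀ p : G, TangentSpace (𝓡 n) p → ℝ)
    (hF' : F' = randersMetric gX X)
    (h_norm : ∀ p, √(h.inner p (X p) (X p)) < 1)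
    (gX_norm : ∀ p, √(gX p (X p) (X p)) < 1) :
    (IsDouglasType F ↔ IsDouglasType F') ∧ (IsBerwaldType F ↔ IsBerwaldType F') := by
  have hman : IsManifold (𝓡 n) ∞ G := inferInstance
  have hconst : ∀ p, h.inner p (X p) (X p) = h.inner 1 v v := fun p => by
    rw [hX]; exact inner_mulInvariantVectorField h_left v p
  have hvpos : 0 < h.inner 1 v v := h.pos 1 v hv
  obtain ⟨b, hb⟩ : ∃ b, b = √(h.inner 1 v v) := ⟨_, rfl⟩
  have hb0 : 0 < b := hb ▸ Real.sqrt_pos.2 hvpos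
  have hXX : ∀ p, h.inner p (X p) (X p) = b ^ 2 := fun p => by
    rw [hconst, hb, Real.sq_sqrt hvpos.le]
  have hX0 : ∀ p, X p ≠ 0 := fun p h0 => by
    have := hconst p
    rw [h0, map_zero] at this
    exact hvpos.ne this
  have hg : ∀ p u w, gX p u w = (1 + b) * h.inner p u w
      + (1 + b) / b * (h.inner p (X p) u * h.inner p (X p) w) := fun p u w => by
    rw [hgX, hF]
    exact fundamentalTensorAlong_randersMetric (hX0 p) (by rw [hconst, hb]) u w
  have hgXu : ∀ p u, gX p (X p) u = (1 + b) ^ 2 * h.inner p (X p) u := fun p u => by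
    rw [hg, hXX]; field_simp
  have hlt : ∀ p, h.inner p (X p) (X p) < 1 := fun p => by
    have := h_norm p
    rwa [Real.sqrt_lt' one_pos, one_pow] at this
  -- By the two preceding formulas g_X(X, X) = (1 + b)²b², so this is the norm hypothesis, read at
  -- the identity.
  have hb1 : (1 + b) * b < 1 := by
    have h1 := gX_norm 1
    rw [hgXu, hXX, ← mul_pow, Real.sqrt_sq (by positivity)] at h1
    exact h1
  have hlie : LieGroup (𝓡 n) (minSmoothness ℝ 3) G := LieGroup.of_le (n := ∞) (by simp; exact ENat.LEInfty.out)
  have hXd : MDifferentiable (𝓡 n) ((𝓡 n).prod (𝓡 n)) (fun p =>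
      (Bundle.TotalSpace.mk' (EuclideanSpace ℝ (Fin n)) p (X p) : TangentBundle (𝓡 n) G)) := by
    rw [hX]; exact mdifferentiable_mulInvariantVectorField v
  have hFe : ∀ e, localExpression F e
      = fun z => randersNorm (chartMetric h e z) (chartForm h X e z) := fun e => by
    rw [hF]; rfl
  -- The metric g_X and its form g_X(X, ·) in a chart, written through h and β so that they are
  -- bilinear and linear by construction.
  let a' := fun (e : OpenPartialHomeomorph G (EuclideanSpace ℝ (Fin n)))
      (z : EuclideanSpace ℝ (Fin n)) => (1 + b) • chartMetric h e z
        + ((1 + b) / b) • (chartForm h X e z).smulRight (chartForm h X e z)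
  let β' := fun (e : OpenPartialHomeomorph G (EuclideanSpace ℝ (Fin n)))
      (z : EuclideanSpace ℝ (Fin n)) => (1 + b) ^ 2 • chartForm h X e z
  have ha' : ∀ e z u w, a' e z u w = (1 + b) * chartMetric h e z u w
      + (1 + b) / b * (chartForm h X e z u * chartForm h X e z w) := fun e z u w => by
    simp [a']
  have hβ' : ∀ e z u, β' e z u = (1 + b) ^ 2 * chartForm h X e z u := fun e z u => rfl
  have hFe' : ∀ e, localExpression F' e = fun z => randersNorm (a' e z) (β' e z) := fun e => by
    funext z y
    rw [hF', randersNorm, ha', hβ']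
    simp only [localExpression, randersMetric]
    rw [hgXu, hg]
    rfl
  have hβb : ∀ e z u, chartForm h X e z u ^ 2 ≤ b ^ 2 * chartMetric h e z u u := fun e z u => by
    rw [← hXX (e.symm z)]
    exact inner_sq_le _ _ _
  rw [isDouglasType_iff, isDouglasType_iff, isBerwaldType_iff, isBerwaldType_iff]
  have hc : (1 + b) ≠ 0 := by positivity
  constructor
  · refine forall₂_congr fun e he => forall₂_congr fun x hx => ?_
    obtain ⟨da, dβ, hR⟩ := exists_isRandersAt_chart he hx hXd hlt
    obtain ⟨da', dβ', hR', -, hdβ'⟩ := hR.perturb hb0 (hβb e x) hb1 (ha' e) (hβ' e)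
    rw [hFe, hFe', hR.douglas_iff, hR'.douglas_iff]
    simp only [hdβ', mul_right_inj' (pow_ne_zero 2 hc)]
  · refine forall₂_congr fun e he => forall₂_congr fun x hx => ?_
    obtain ⟨da, dβ, hR⟩ := exists_isRandersAt_chart he hx hXd hlt
    obtain ⟨da', dβ', hR', hda', hdβ'⟩ := hR.perturb hb0 (hβb e x) hb1 (ha' e) (hβ' e)
    rw [hFe, hFe', hR.berwald_iff, hR'.berwald_iff]
    exact isParallelForm_perturb_iff hc (pow_ne_zero 2 hc) (ha' e x) (hβ' e x) hda' hdβ'
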